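/- Fix $\alpha>0$. For each integer $N\ge 1$ let $M=M_N$ be the integer part of $N^{1+\alpha}$, and let $(\omega_t)_{t\ge0}=(\eta(\cdot,t),n_-(t),n_+(t))_{t\ge 0}$ be a continuous-time Markov process with state space $\{0,1\}^{\{1,\dots,N\}}\times\{0,\dots,M\}\times\{0,\dots,M\}$ and generator $$\mathbf L f(\omega)=\tfrac12\sum_{x=1}^{N-1}\big[f(\omega^{x,x+1})-f(\omega)\big]+c_N(\omega)\big[f(\omega^N)-f(\omega)\big]+c_1(\omega)\big[f(\omega^1)-f(\omega)\big].$$ Here $\omega^{x,x+1}$ is $\omega$ with $\eta(x)$ and $\eta(x+1)$ exchanged; $$c_N(\omega)=\tfrac12\Big(1-\frac{n_+}{M}\Big)\eta(N)+\tfrac12\,\frac{n_+}{M}\,(1-\eta(N)),\qquad c_1(\omega)=\tfrac12\Big(1-\frac{n_-}{M}\Big)\eta(1)+\tfrac12\,\frac{n_-}{M}\,(1-\eta(1));$$ in $\omega^N$ the occupation $\eta(N)$ is replaced by $1-\eta(N)$ and $n_+$ by $n_++1$ if $\eta(N)=1$, by $n_+-1$ if $\eta(N)=0$; and $\omega^1$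 is defined in the same way with the site $1$ and $n_-$. Set $\eta(0,t)=n_-(t)/M$, $\eta(N+1,t)=n_+(t)/M$, and, with $\varepsilon=1/N$, $$\rho^\varepsilon(x,t)=\mathbf E[\eta(x,t)]\quad(0\le x\le N+1),\qquad \rho^\varepsilon_-(t)=\rho^\varepsilon(0,t),\quad \rho^\varepsilon_+(t)=\rho^\varepsilon(N+1,t).$$ **Theorem (Global equilibrium limit).** Let $v_{0,\pm}\in[0,1]$ and suppose that the initial laws, otherwise arbitrary, satisfy $\rho^\varepsilon_\pm(0)=v_{0,\pm}$ for every $N\ge1$. Then for every $\alpha'>\alpha$, $r\in[0,1]$ and $t>0$, $$\lim_{N\to\infty}\rho^\varepsilon([Nr],N^{2+\alpha'}t)=\lim_{N\to\infty}\rho^\varepsilon_-(N^{2+\alpha'}t)=\lim_{N\to\infty}\rho^\varepsilon_+(N^{2+\alpha'}t)=\frac{v_{0,-}+v_{0,+}}2,$$ where $[Nr]$ is the integer part of $Nr$. -/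

import Mathlib

open MeasureTheory Filter Topology
open scoped NNReal

namespace SSEPReservoirs

/-- The channel `Λ_N = {1, …, N}`, for a positive integer `N`. -/
abbrev Channel (N : ℕ+) : Type := ↥(Finset.Icc 1 (N : ℕ))

/-- The leftmost site `1` of the channel. -/
def leftSite (N : ℕ+) : Channel N := ⟨1, Finset.mem_Icc.2 ⟨le_rfl, N.pos⟩⟩

/-- The rightmost site `N` of the channel. -/
def rightSite (N : ℕ+) : Channel N := ⟨(N : ℕ), Finset.mem_Icc.2 ⟨N.pos, le_rfl⟩⟩

/-- The state space `{0,1}^{Λ_N} × {0,…,M} × {0,…,M}`; a state is `(η, n₋, n₊)`, where `η` is the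
configuration of the channel (`true` means that the site is occupied) and `n₋`, `n₊` are the
numbers of particles in the left and in the right reservoir. -/
abbrev State (N : ℕ+) (M : ℕ) : Type := (Channel N → Bool) × Fin (M + 1) × Fin (M + 1)

variable {N : ℕ+} {M : ℕ}

/-- The number of particles (0 or 1) at a site of the channel. -/
def State.eta (ω : State N M) (x : Channel N) : ℝ := if ω.1 x then 1 else 0

/-- The density `n₋ / M` of the left reservoir. -/
noncomputable def State.densMinus (ω : State N M) : ℝ := (ω.2.1 : ℕ) / (M : ℝ)

/-- The density `n₊ / M` of the right reservoir. -/
noncomputable def State.densPlus (ω : State N M) : ℝ := (ω.2.2 : ℕ) / (M : ℝ)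

/-- The occupation variable on `{0, …, N+1}`: `η(x)` at the sites of the channel, `n₋ / M` at `0`
and `n₊ / M` at `N + 1` (and, as a convention, `0` beyond `N + 1`). -/
noncomputable def State.occ (ω : State N M) (x : ℕ) : ℝ :=
  if x = 0 then ω.densMinus
  else if x = N + 1 then ω.densPlus
  else if h : x ∈ Finset.Icc 1 (N : ℕ) then ω.eta ⟨x, h⟩ else 0

/-- `ω^{x,y}`: the occupations of the channel sites `x` and `y` are exchanged. -/
def State.exchange (ω : State N M) (x y : Channel N) : State N M :=
  (fun z => ω.1 (Equiv.swap x y z), ω.2)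

/-- A reservoir gains a particle. (At `n = M` nothing happens; the corresponding rate is zero.) -/
def gain (n : Fin (M + 1)) : Fin (M + 1) :=
  ⟨min (n + 1) M, Nat.lt_succ_of_le (min_le_right _ _)⟩

/-- A reservoir loses a particle. (At `n = 0` nothing happens; the corresponding rate is zero.) -/
def lose (n : Fin (M + 1)) : Fin (M + 1) :=
  ⟨n - 1, lt_of_le_of_lt (Nat.sub_le _ _) n.2⟩

/-- `ω^1`: if site `1` is occupied, its particle moves to the left reservoir; if it is empty, a
particle of the left reservoir moves there. -/
def State.flipLeft (ω : State N M) : State N M :=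
  (Function.update ω.1 (leftSite N) (!ω.1 (leftSite N)),
    if ω.1 (leftSite N) then gain ω.2.1 else lose ω.2.1, ω.2.2)

/-- `ω^N`: if site `N` is occupied, its particle moves to the right reservoir; if it is empty, a
particle of the right reservoir moves there. -/
def State.flipRight (ω : State N M) : State N M :=
  (Function.update ω.1 (rightSite N) (!ω.1 (rightSite N)), ω.2.1,
    if ω.1 (rightSite N) then gain ω.2.2 else lose ω.2.2)

/-- The rate `c_1(ω)` of exchange between site `1` and the left reservoir. -/
noncomputable def State.rateLeft (ω : State N M) : ℝ :=
  1 / 2 * (1 - ω.densMinus) * ω.eta (leftSite N) + 1 / 2 * ω.densMinus * (1 - ω.eta (leftSite N))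

/-- The rate `c_N(ω)` of exchange between site `N` and the right reservoir. -/
noncomputable def State.rateRight (ω : State N M) : ℝ :=
  1 / 2 * (1 - ω.densPlus) * ω.eta (rightSite N) + 1 / 2 * ω.densPlus * (1 - ω.eta (rightSite N))

/-- The generator
`L f(ω) = ½ ∑_{x=1}^{N-1} [f(ω^{x,x+1}) - f(ω)] + c_N(ω) [f(ω^N) - f(ω)] + c_1(ω) [f(ω^1) - f(ω)]`
acting on the functions on the (finite) state space. -/
noncomputable def generator (N : ℕ+) (M : ℕ) : (State N M → ℝ) →ₗ[ℝ] (State N M → ℝ) where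
  toFun f ω :=
    1 / 2 * (∑ p : Channel N × Channel N with (p.2 : ℕ) = (p.1 : ℕ) + 1,
      (f (ω.exchange p.1 p.2) - f ω))
    + ω.rateRight * (f ω.flipRight - f ω)
    + ω.rateLeft * (f ω.flipLeft - f ω)
  map_add' f g := by
    funext ω
    simp only [Pi.add_apply, add_sub_add_comm, Finset.sum_add_distrib]
    ring
  map_smul' c f := by
    funext ω
    simp only [Pi.smul_apply, smul_eq_mul, ← mul_sub, ← Finset.mul_sum, RingHom.id_apply]
    ring

/-- The semigroup `e^{tL}` generated by an operator `L` on the functions on a finite set. -/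
noncomputable def semigroup {S : Type*} [Fintype S] (L : (S → ℝ) →ₗ[ℝ] (S → ℝ)) (t : ℝ≥0) :
    (S → ℝ) →L[ℝ] (S → ℝ) :=
  NormedSpace.exp ((t : ℝ) • LinearMap.toContinuousLinearMap L)

/-- `X` is a (time-homogeneous, continuous-time) Markov process with generator `L` on the finite
state space `S`, under the probability measure `P`: for all times `s, t` and all functions `f`,
`E[f(X_{s+t}) | σ(X_u, u ≤ s)] = (e^{tL} f)(X_s)` almost surely. Its initial law is arbitrary. -/
structure IsMarkovProcess {S : Type*} [Fintype S] [mS : MeasurableSpace S]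
    (L : (S → ℝ) →ₗ[ℝ] (S → ℝ)) {Ω : Type*} [MeasurableSpace Ω] (P : Measure Ω)
    (X : ℝ≥0 → Ω → S) : Prop where
  measurable : ∀ t, Measurable (X t)
  markov : ∀ (s t : ℝ≥0) (f : S → ℝ),
    P[fun a => f (X (s + t) a) | ⨆ u ≤ s, mS.comap (X u)]
      =ᵐ[P] fun a => semigroup L t f (X s a)

/-- The size `M = N^{1+α}` of each reservoir (integer part). -/
noncomputable def reservoirSize (α : ℝ) (N : ℕ+) : ℕ := ⌊((N : ℕ) : ℝ) ^ (1 + α)⌋₊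

/-- The density `ρ(x, t) = E[η(x, t)]`, `x ∈ {0, …, N+1}`, of a process `X`; the left and the right
reservoir are `x = 0` and `x = N + 1`. -/
noncomputable def rho {Ω : Type*} [MeasurableSpace Ω] (P : Measure Ω)
    (X : ℝ≥0 → Ω → State N M) (x : ℕ) (t : ℝ≥0) : ℝ :=
  ∫ a, (X t a).occ x ∂P

end SSEPReservoirs

/-! The occupation variables satisfy a closed linear system: exclusion does not couple one-point
functions to higher correlations, and multiplying the reservoir rates by the jumps leaves linear
expressions (`mass_mul_generator_occ`). So the densities solve a discrete heat equation on `{0, …,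
N+1}` with heat capacity `M` at the end points and no flux out of them.

The weighted total is conserved, so the only possible limit is the weighted mean. The channel has
weight `N` against `2M`, hence this mean is within `N / M`, of order `N^(-α)`, of the average of the
initial reservoir densities, whatever the channel holds (`abs_meanDensity_sub_le`).

The weighted `L²` distance to the mean decays exponentially, with relaxation time at most
`(2M+N)(N+1)`, of order `N^(2+α)`, by the inequality `poincare`. At time `N^(2+α') t` the exponent
is at least of order `N^(α'-α)` and beats the polynomial bound `2M+N` on the initial energy
(`tendsto_relaxation_bound`). -/

namespace SSEPReservoirs

/-! ### The discrete heat equation with heavy end points -/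

/-- The reversible measure of the walk on `{0, …, N + 1}`: mass `M` at the end points, mass `1`
in between. -/
def mass (N M : ℕ) (x : ℕ) : ℝ := if x = 0 ∨ x = N + 1 then M else 1

/-- The current of a profile `a` on `{0, …, N + 1}` through the bond `{x - 1, x}`. -/
def current (N : ℕ) (a : ℕ → ℝ) (x : ℕ) : ℝ :=
  -- Zero current at `0` and `N + 2` encodes the no-flux boundary: the end points then obey the same
  -- equation as the other sites.
  if x = 0 ∨ N + 1 < x then 0 else a x - a (x - 1)

theorem current_zero (N : ℕ) (a : ℕ → ℝ) : current N a 0 = 0 := by simp [current]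

theorem current_last (N : ℕ) (a : ℕ → ℝ) : current N a (N + 2) = 0 := by simp [current]

theorem current_succ {N x : ℕ} (hx : x < N + 1) (a : ℕ → ℝ) :
    current N a (x + 1) = a (x + 1) - a x := by
  simp [current, show ¬ N < x by omega]

theorem current_sub_const (N : ℕ) (a : ℕ → ℝ) (c : ℝ) (x : ℕ) :
    current N (fun y => a y - c) x = current N a x := by
  unfold current; split_ifs <;> ring

theorem mass_nonneg (N M x : ℕ) : 0 ≤ mass N M x := by
  unfold mass; split_ifs <;> positivity

theorem one_le_mass {M : ℕ} (hM : 1 ≤ M) (N x : ℕ) : 1 ≤ mass N M x := by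
  unfold mass; split_ifs
  · exact_mod_cast hM
  · exact le_rfl

theorem sum_mass_mul (N M : ℕ) (a : ℕ → ℝ) :
    ∑ x ∈ Finset.range (N + 2), mass N M x * a x
      = M * a 0 + M * a (N + 1) + ∑ x ∈ Finset.range N, a (x + 1) := by
  rw [Finset.sum_range_succ, Finset.sum_range_succ']
  have : ∑ x ∈ Finset.range N, mass N M (x + 1) * a (x + 1) = ∑ x ∈ Finset.range N, a (x + 1) := by
    refine Finset.sum_congr rfl fun x hx => ?_
    have : x ≠ N := (Finset.mem_range.1 hx).ne
    simp [mass, this]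
  rw [this]
  simp [mass]
  ring

theorem sum_mass (N M : ℕ) : ∑ x ∈ Finset.range (N + 2), mass N M x = 2 * M + N := by
  have := sum_mass_mul N M (fun _ => 1)
  simp only [mul_one, Finset.sum_const, Finset.card_range, nsmul_eq_mul] at this
  rw [this]; ring

theorem sum_range_mul_sub_eq (a j : ℕ → ℝ) (k : ℕ) :
    ∑ x ∈ Finset.range k, a x * (j (x + 1) - j x)
      = a k * j k - a 0 * j 0 - ∑ x ∈ Finset.range k, (a (x + 1) - a x) * j (x + 1) := by
  induction k with
  | zero => simp
  | succ k ih => rw [Finset.sum_range_succ, Finset.sum_range_succ, ih]; ring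

/-- Summation by parts; the boundary terms, including the irrelevant value `a (N + 2)`, are killed
by the vanishing outer currents. -/
theorem sum_mul_current_sub (N : ℕ) (a : ℕ → ℝ) :
    ∑ x ∈ Finset.range (N + 2), a x * (current N a (x + 1) - current N a x)
      = -∑ x ∈ Finset.range (N + 1), (a (x + 1) - a x) ^ 2 := by
  rw [sum_range_mul_sub_eq, current_zero, current_last, Finset.sum_range_succ, current_last]
  have : ∑ x ∈ Finset.range (N + 1), (a (x + 1) - a x) * current N a (x + 1)
      = ∑ x ∈ Finset.range (N + 1), (a (x + 1) - a x) ^ 2 :=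
    Finset.sum_congr rfl fun x hx => by rw [current_succ (Finset.mem_range.1 hx)]; ring
  rw [this]; ring

/-- Cauchy–Schwarz on the telescoping sum of at most `N + 1` increments. -/
theorem sq_sub_le_mul_sum_sq (N : ℕ) (a : ℕ → ℝ) {x : ℕ} (hx : x ≤ N + 1) :
    (a x - a 0) ^ 2 ≤ (N + 1) * ∑ y ∈ Finset.range (N + 1), (a (y + 1) - a y) ^ 2 := by
  rw [← Finset.sum_range_sub a x]
  refine sq_sum_le_card_mul_sum_sq.trans ?_
  rw [Finset.card_range]
  gcongr
  exact_mod_cast hx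

/-- For a profile of mean zero, replacing the mean by the reference value `a 0` only increases the
variance; each `a x - a 0` is then bounded by the energy, and the weights add up to `2M + N`. -/
theorem poincare {N M : ℕ} (a : ℕ → ℝ) (ha : ∑ x ∈ Finset.range (N + 2), mass N M x * a x = 0) :
    ∑ x ∈ Finset.range (N + 2), mass N M x * a x ^ 2
      ≤ (2 * M + N) * (N + 1) * ∑ y ∈ Finset.range (N + 1), (a (y + 1) - a y) ^ 2 := by
  have key : ∑ x ∈ Finset.range (N + 2), mass N M x * (a x - a 0) ^ 2
      = ∑ x ∈ Finset.range (N + 2), mass N M x * a x ^ 2 + (2 * M + N) * a 0 ^ 2 := by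
    have h : ∀ x, mass N M x * (a x - a 0) ^ 2
        = mass N M x * a x ^ 2 - 2 * a 0 * (mass N M x * a x) + mass N M x * a 0 ^ 2 :=
      fun x => by ring
    simp only [h, Finset.sum_add_distrib, Finset.sum_sub_distrib, ← Finset.mul_sum, ha,
      ← Finset.sum_mul, sum_mass]
    ring
  calc ∑ x ∈ Finset.range (N + 2), mass N M x * a x ^ 2
      ≤ ∑ x ∈ Finset.range (N + 2), mass N M x * (a x - a 0) ^ 2 := by
        rw [key]; exact le_add_of_nonneg_right (by positivity)
    _ ≤ ∑ x ∈ Finset.range (N + 2), mass N M x *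
          ((N + 1) * ∑ y ∈ Finset.range (N + 1), (a (y + 1) - a y) ^ 2) := by
        refine Finset.sum_le_sum fun x hx => ?_
        exact mul_le_mul_of_nonneg_left
          (sq_sub_le_mul_sum_sq N a (by have := Finset.mem_range.1 hx; omega)) (mass_nonneg _ _ _)
    _ = _ := by rw [← Finset.sum_mul, sum_mass]; ring

/-- The equilibrium density of a profile. -/
noncomputable def meanDensity (N M : ℕ) (a : ℕ → ℝ) : ℝ :=
  (∑ x ∈ Finset.range (N + 2), mass N M x * a x) / (2 * M + N)

theorem meanDensity_mem_Icc {N M : ℕ} (hM : 1 ≤ M) {a : ℕ → ℝ}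
    (ha : ∀ x ≤ N + 1, a x ∈ Set.Icc (0 : ℝ) 1) : meanDensity N M a ∈ Set.Icc (0 : ℝ) 1 := by
  have hM' : (1 : ℝ) ≤ M := by exact_mod_cast hM
  have ha' : ∀ x ∈ Finset.range (N + 2), a x ∈ Set.Icc (0 : ℝ) 1 := fun x hx =>
    ha x (by have := Finset.mem_range.1 hx; omega)
  refine ⟨div_nonneg (Finset.sum_nonneg fun x hx => mul_nonneg (mass_nonneg _ _ _) (ha' x hx).1)
    (by positivity), div_le_one_of_le₀ ?_ (by positivity)⟩
  rw [← sum_mass]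
  exact Finset.sum_le_sum fun x hx => mul_le_of_le_one_right (mass_nonneg _ _ _) (ha' x hx).2

/-- Exponential convergence to equilibrium of the discrete heat equation. -/
theorem sq_sub_meanDensity_le {N M : ℕ} (hM : 1 ≤ M) (u u' : ℕ → ℝ → ℝ)
    (hu : ∀ x ≤ N + 1, ∀ t, HasDerivAt (u x) (u' x t) t)
    (hu' : ∀ x ≤ N + 1, ∀ t, mass N M x * u' x t =
      1 / 2 * (current N (fun y => u y t) (x + 1) - current N (fun y => u y t) x))
    (h0 : ∀ x ≤ N + 1, u x 0 ∈ Set.Icc (0 : ℝ) 1) {x : ℕ} (hx : x ≤ N + 1) {t : ℝ} (ht : 0 ≤ t) :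
    (u x t - meanDensity N M (fun y => u y 0)) ^ 2
      ≤ (2 * M + N) * Real.exp (-(t / ((2 * M + N) * (N + 1)))) := by
  set c := meanDensity N M (fun y => u y 0) with hc
  have hM' : (1 : ℝ) ≤ M := by exact_mod_cast hM
  have hZ : (0 : ℝ) < 2 * M + N := by positivity
  have mem : ∀ {y}, y ∈ Finset.range (N + 2) → y ≤ N + 1 := fun hy => by
    have := Finset.mem_range.1 hy; omega
  set k : ℝ := 1 / ((2 * M + N) * (N + 1)) with hk
  have hkpos : 0 < k := by positivity
  -- conservation of mass
  have hmass : ∀ s, ∑ y ∈ Finset.range (N + 2), mass N M y * (u y s - c) = 0 := by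
    have hd : ∀ s, HasDerivAt (fun s => ∑ y ∈ Finset.range (N + 2), mass N M y * (u y s - c))
        0 s := by
      intro s
      have h1 := HasDerivAt.fun_sum (u := Finset.range (N + 2))
        (A := fun y s => mass N M y * (u y s - c)) (A' := fun y => mass N M y * u' y s) (x := s)
        fun y hy => ((hu y (mem hy) s).sub_const c).const_mul _
      refine h1.congr_deriv ?_
      -- The differences of currents telescope to the two outer currents, both zero.
      rw [Finset.sum_congr rfl fun y hy => hu' y (mem hy) s, ← Finset.mul_sum,
        Finset.sum_range_sub, current_zero, current_last]
      ring
    intro s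
    have hconst := is_const_of_deriv_eq_zero (fun s => (hd s).differentiableAt)
      (fun s => (hd s).deriv) s 0
    rw [hconst]
    simp only [mul_sub, Finset.sum_sub_distrib, ← Finset.sum_mul, sum_mass]
    rw [hc, meanDensity, mul_div_cancel₀ _ hZ.ne', sub_self]
  -- dissipation of energy
  let F : ℝ → ℝ := fun s => ∑ y ∈ Finset.range (N + 2), mass N M y * (u y s - c) ^ 2
  let D : ℝ → ℝ := fun s => ∑ y ∈ Finset.range (N + 1), ((u (y + 1) s - c) - (u y s - c)) ^ 2
  have hF : ∀ s, HasDerivAt F (-D s) s := by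
    intro s
    have h1 := HasDerivAt.fun_sum (u := Finset.range (N + 2))
        (A := fun y s => mass N M y * (u y s - c) ^ 2)
        (A' := fun y => mass N M y * (2 * (u y s - c) * u' y s)) (x := s)
        fun y hy => by
          simpa using (((hu y (mem hy) s).sub_const c).pow 2).const_mul (mass N M y)
    refine h1.congr_deriv ?_
    refine Eq.trans ?_ (sum_mul_current_sub N fun y => u y s - c)
    refine Finset.sum_congr rfl fun y hy => ?_
    have := hu' y (mem hy) s
    rw [current_sub_const, current_sub_const]
    linear_combination (2 * (u y s - c)) * this
  have hFD : ∀ s, k * F s ≤ D s := by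
    intro s
    have := poincare (N := N) (M := M) (fun y => u y s - c) (hmass s)
    rw [hk, one_div, inv_mul_le_iff₀ (by positivity)]
    exact this
  have hG : ∀ s, HasDerivAt (fun s => F s * Real.exp (k * s))
      (-D s * Real.exp (k * s) + F s * (Real.exp (k * s) * k)) s := by
    intro s
    refine (hF s).mul ?_
    simpa using ((hasDerivAt_id s).const_mul k).exp
  -- Grönwall: the derivative is `(k F - D) e^{ks}`, nonpositive by the Poincaré inequality.
  have hanti : Antitone fun s => F s * Real.exp (k * s) := by
    refine antitone_of_deriv_nonpos (fun s => (hG s).differentiableAt) fun s => ?_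
    rw [(hG s).deriv]
    nlinarith [hFD s, Real.exp_pos (k * s)]
  have hFt : F t * Real.exp (k * t) ≤ F 0 := by simpa using hanti ht
  have hF0 : F 0 ≤ 2 * M + N := by
    rw [← sum_mass]
    refine Finset.sum_le_sum fun y hy => mul_le_of_le_one_right (mass_nonneg _ _ _) ?_
    have h1 := h0 y (mem hy)
    have h2 := meanDensity_mem_Icc (M := M) hM h0
    rw [sq_le_one_iff_abs_le_one, abs_le]
    constructor <;> linarith [h1.1, h1.2, h2.1, h2.2]
  -- All weights are at least `1`, so the energy controls each site.
  have hxF : (u x t - c) ^ 2 ≤ F t := by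
    refine (le_mul_of_one_le_left (sq_nonneg _) (one_le_mass hM N x)).trans ?_
    exact Finset.single_le_sum (f := fun y => mass N M y * (u y t - c) ^ 2)
      (fun y _ => mul_nonneg (mass_nonneg _ _ _) (sq_nonneg _)) (Finset.mem_range.2 (by omega))
  have : t / ((2 * M + N) * (N + 1)) = k * t := by rw [hk]; ring
  rw [this, Real.exp_neg, ← div_eq_mul_inv, le_div_iff₀ (Real.exp_pos _)]
  exact (mul_le_mul_of_nonneg_right hxF (Real.exp_pos _).le).trans (hFt.trans hF0)

theorem abs_meanDensity_sub_le {N M : ℕ} (hM : 1 ≤ M) {a : ℕ → ℝ}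
    (ha : ∀ x ≤ N + 1, a x ∈ Set.Icc (0 : ℝ) 1) :
    |meanDensity N M a - (a 0 + a (N + 1)) / 2| ≤ N / M := by
  have hM' : (1 : ℝ) ≤ M := by exact_mod_cast hM
  have hZ : (0 : ℝ) < 2 * M + N := by positivity
  have hs0 : 0 ≤ ∑ x ∈ Finset.range N, a (x + 1) := Finset.sum_nonneg fun x hx =>
    (ha (x + 1) (by have := Finset.mem_range.1 hx; omega)).1
  have hs1 : ∑ x ∈ Finset.range N, a (x + 1) ≤ N := by
    refine (Finset.sum_le_card_nsmul _ _ 1 fun x hx =>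
      (ha (x + 1) (by have := Finset.mem_range.1 hx; omega)).2).trans (by simp)
  have h1 := ha 0 (by omega)
  have h2 := ha (N + 1) le_rfl
  have hN : (0 : ℝ) ≤ N := by positivity
  have : meanDensity N M a - (a 0 + a (N + 1)) / 2
      = (∑ x ∈ Finset.range N, a (x + 1) - N * ((a 0 + a (N + 1)) / 2)) / (2 * M + N) := by
    rw [meanDensity, sum_mass_mul]; field_simp; ring
  rw [this, abs_div, abs_of_pos hZ]
  refine div_le_div₀ hN ?_ (by linarith) (by linarith)
  rw [abs_le]
  constructor <;> nlinarith [h1.1, h1.2, h2.1, h2.2]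

/-! ### The generator acting on the occupation variables -/

section Generator
variable {N : ℕ+} {M : ℕ}

theorem State.occ_zero (ω : State N M) : ω.occ 0 = ω.densMinus := by simp [State.occ]

theorem State.occ_last (ω : State N M) : ω.occ (N + 1) = ω.densPlus := by simp [State.occ]

theorem State.occ_channel (ω : State N M) (x : Channel N) : ω.occ x = ω.eta x := by
  have h := Finset.mem_Icc.1 x.2
  have h0 : (x : ℕ) ≠ 0 := by omega
  have h1 : (x : ℕ) ≠ N + 1 := by omega
  rw [State.occ, if_neg h0, if_neg h1, dif_pos x.2]

theorem State.eta_mem_Icc (ω : State N M) (x : Channel N) : ω.eta x ∈ Set.Icc (0 : ℝ) 1 := by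
  unfold State.eta; split_ifs <;> simp

theorem natCast_fin_div_mem_Icc (n : Fin (M + 1)) : ((n : ℕ) : ℝ) / M ∈ Set.Icc (0 : ℝ) 1 :=
  ⟨by positivity, div_le_one_of_le₀ (by exact_mod_cast Nat.lt_succ_iff.1 n.2) (by positivity)⟩

theorem State.occ_mem_Icc (ω : State N M) (x : ℕ) : ω.occ x ∈ Set.Icc (0 : ℝ) 1 := by
  unfold State.occ
  split_ifs
  · exact natCast_fin_div_mem_Icc _
  · exact natCast_fin_div_mem_Icc _
  · exact State.eta_mem_Icc _ _
  · simp

theorem State.eta_exchange_sub (ω : State N M) {x y : Channel N} (hxy : x ≠ y) (z : Channel N) :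
    (ω.exchange x y).eta z - ω.eta z
      = (if x = z then ω.eta y - ω.eta z else 0) + (if y = z then ω.eta x - ω.eta z else 0) := by
  by_cases h1 : x = z
  · subst h1
    simp [State.eta, State.exchange, hxy.symm]
  · by_cases h2 : y = z
    · subst h2
      simp [State.eta, State.exchange, h1]
    · simp [State.eta, State.exchange, h1, h2,
        Equiv.swap_apply_of_ne_of_ne (Ne.symm h1) (Ne.symm h2)]

theorem State.eta_flipRight_sub (ω : State N M) (z : Channel N) :
    ω.flipRight.eta z - ω.eta z = if z = rightSite N then 1 - 2 * ω.eta z else 0 := by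
  by_cases h : z = rightSite N
  · subst h
    cases hη : ω.1 (rightSite N) <;> simp [State.eta, State.flipRight, hη]; norm_num
  · simp [State.eta, State.flipRight, h]

theorem State.eta_flipLeft_sub (ω : State N M) (z : Channel N) :
    ω.flipLeft.eta z - ω.eta z = if z = leftSite N then 1 - 2 * ω.eta z else 0 := by
  by_cases h : z = leftSite N
  · subst h
    cases hη : ω.1 (leftSite N) <;> simp [State.eta, State.flipLeft, hη]; norm_num
  · simp [State.eta, State.flipLeft, h]

/-- A flip changes `η` by `1 - 2η`. Since `η` is `0` or `1`, the product with the rate loses its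
quadratic terms, which is what closes the equations. -/
theorem State.rateLeft_mul (ω : State N M) :
    ω.rateLeft * (1 - 2 * ω.eta (leftSite N)) = 1 / 2 * (ω.densMinus - ω.eta (leftSite N)) := by
  cases h : ω.1 (leftSite N) <;> simp [State.rateLeft, State.eta, h]
  ring

theorem State.rateRight_mul (ω : State N M) :
    ω.rateRight * (1 - 2 * ω.eta (rightSite N))
      = 1 / 2 * (ω.densPlus - ω.eta (rightSite N)) := by
  cases h : ω.1 (rightSite N) <;> simp [State.rateRight, State.eta, h]
  ring

/-- The truncation in `gain` is harmless: at `n = M` the factor `1 - n / M` vanishes. -/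
theorem one_sub_mul_gain_sub (hM : 1 ≤ M) (n : Fin (M + 1)) :
    (M : ℝ) * ((1 - (n : ℕ) / (M : ℝ)) * ((gain n : ℕ) / (M : ℝ) - (n : ℕ) / (M : ℝ)))
      = 1 - (n : ℕ) / (M : ℝ) := by
  have hM' : (M : ℝ) ≠ 0 := by positivity
  rcases (Nat.lt_succ_iff.1 n.2).eq_or_lt with h | h
  · simp [h, hM']
  · have : ((gain n : ℕ) : ℝ) = (n : ℕ) + 1 := by
      rw [gain]; simp only [min_eq_left (Nat.succ_le_of_lt h)]; push_cast; rfl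
    rw [this]; field_simp; ring

theorem mul_lose_sub (hM : 1 ≤ M) (n : Fin (M + 1)) :
    (M : ℝ) * ((n : ℕ) / (M : ℝ) * ((lose n : ℕ) / (M : ℝ) - (n : ℕ) / (M : ℝ)))
      = -((n : ℕ) / (M : ℝ)) := by
  have hM' : (M : ℝ) ≠ 0 := by positivity
  rcases Nat.eq_zero_or_pos (n : ℕ) with h | h
  · simp [h]
  · have : ((lose n : ℕ) : ℝ) = (n : ℕ) - 1 := by
      rw [lose]; push_cast [Nat.cast_sub h]; rfl
    rw [this]; field_simp; ring

theorem State.rateLeft_mul_densMinus (hM : 1 ≤ M) (ω : State N M) :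
    (M : ℝ) * (ω.rateLeft * (ω.flipLeft.densMinus - ω.densMinus))
      = 1 / 2 * (ω.eta (leftSite N) - ω.densMinus) := by
  cases h : ω.1 (leftSite N)
  · simp only [State.rateLeft, State.eta, h, State.densMinus, State.flipLeft]
    simp only [Bool.false_eq_true, if_false]
    linear_combination (1 / 2) * mul_lose_sub hM ω.2.1
  · simp only [State.rateLeft, State.eta, h, State.densMinus, State.flipLeft]
    simp only [if_true]
    linear_combination (1 / 2) * one_sub_mul_gain_sub hM ω.2.1

theorem State.rateRight_mul_densPlus (hM : 1 ≤ M) (ω : State N M) :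
    (M : ℝ) * (ω.rateRight * (ω.flipRight.densPlus - ω.densPlus))
      = 1 / 2 * (ω.eta (rightSite N) - ω.densPlus) := by
  cases h : ω.1 (rightSite N)
  · simp only [State.rateRight, State.eta, h, State.densPlus, State.flipRight]
    simp only [Bool.false_eq_true, if_false]
    linear_combination (1 / 2) * mul_lose_sub hM ω.2.2
  · simp only [State.rateRight, State.eta, h, State.densPlus, State.flipRight]
    simp only [if_true]
    linear_combination (1 / 2) * one_sub_mul_gain_sub hM ω.2.2

theorem generator_apply (f : State N M → ℝ) (ω : State N M) :
    generator N M f ω =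
      1 / 2 * (∑ p : Channel N × Channel N with (p.2 : ℕ) = (p.1 : ℕ) + 1,
        (f (ω.exchange p.1 p.2) - f ω))
      + ω.rateRight * (f ω.flipRight - f ω) + ω.rateLeft * (f ω.flipLeft - f ω) := rfl

/-- Only the bonds `{z, z+1}` and `{z-1, z}` contribute. The one missing at an end of the channel is
supplied by the reservoir flip in `generator_occ_channel`. -/
theorem sum_eta_exchange_sub (ω : State N M) (z : Channel N) :
    ∑ p : Channel N × Channel N with (p.2 : ℕ) = (p.1 : ℕ) + 1,
        ((ω.exchange p.1 p.2).eta z - ω.eta z)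
      = (if (z : ℕ) = N then 0 else ω.occ (z + 1) - ω.occ z)
        + (if (z : ℕ) = 1 then 0 else ω.occ (z - 1) - ω.occ z) := by
  have hz := Finset.mem_Icc.1 z.2
  have h : ∀ p ∈ Finset.univ.filter fun p : Channel N × Channel N => (p.2 : ℕ) = (p.1 : ℕ) + 1,
      (ω.exchange p.1 p.2).eta z - ω.eta z = (if p.1 = z then ω.eta p.2 - ω.eta z else 0)
        + (if p.2 = z then ω.eta p.1 - ω.eta z else 0) := fun p hp => by
    refine ω.eta_exchange_sub (fun h => ?_) z
    have := (Finset.mem_filter.1 hp).2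
    rw [h] at this
    omega
  rw [Finset.sum_congr rfl h, Finset.sum_add_distrib]
  congr 1
  · split_ifs with hN
    · refine Finset.sum_eq_zero fun p hp => if_neg fun hpz => ?_
      have h1 := (Finset.mem_filter.1 hp).2
      have h2 := Finset.mem_Icc.1 p.2.2
      rw [hpz] at h1
      omega
    · have hw : (z : ℕ) + 1 ∈ Finset.Icc 1 (N : ℕ) := Finset.mem_Icc.2 (by omega)
      rw [Finset.sum_eq_single (z, (⟨z + 1, hw⟩ : Channel N))]
      · simp only [if_true]
        rw [← State.occ_channel, ← State.occ_channel]
      · intro p hp hne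
        refine if_neg fun hpz => hne ?_
        have h1 := (Finset.mem_filter.1 hp).2
        refine Prod.ext hpz (Subtype.ext ?_)
        rw [h1, hpz]
      · simp
  · split_ifs with hN
    · refine Finset.sum_eq_zero fun p hp => if_neg fun hpz => ?_
      have h1 := (Finset.mem_filter.1 hp).2
      have h2 := Finset.mem_Icc.1 p.1.2
      rw [hpz] at h1
      omega
    · have hw : (z : ℕ) - 1 ∈ Finset.Icc 1 (N : ℕ) := Finset.mem_Icc.2 (by omega)
      rw [Finset.sum_eq_single ((⟨z - 1, hw⟩ : Channel N), z)]
      · simp only [if_true]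
        rw [← State.occ_channel, ← State.occ_channel]
      · intro p hp hne
        refine if_neg fun hpz => hne ?_
        have h1 := (Finset.mem_filter.1 hp).2
        refine Prod.ext (Subtype.ext ?_) hpz
        rw [hpz] at h1
        change (p.1 : ℕ) = (z : ℕ) - 1
        omega
      · intro hnot
        exact absurd (Finset.mem_filter.2 ⟨Finset.mem_univ _, by
          change (z : ℕ) = (z : ℕ) - 1 + 1; omega⟩) hnot

theorem generator_occ_channel (ω : State N M) (z : Channel N) :
    generator N M (fun ω => ω.occ z) ω
      = 1 / 2 * ((ω.occ (z + 1) - ω.occ z) - (ω.occ z - ω.occ (z - 1))) := by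
  rw [generator_apply]
  simp only [State.occ_channel]
  rw [sum_eta_exchange_sub, State.eta_flipLeft_sub, State.eta_flipRight_sub]
  simp only [State.occ_channel]
  have hL : ω.rateLeft * (if z = leftSite N then 1 - 2 * ω.eta z else 0)
      = if (z : ℕ) = 1 then 1 / 2 * (ω.occ (z - 1) - ω.eta z) else 0 := by
    by_cases h : z = leftSite N
    · subst h
      simp only [if_true, State.rateLeft_mul]
      simp [leftSite, State.occ_zero]
    · rw [if_neg h, mul_zero, if_neg]
      exact fun h' => h (Subtype.ext h')
  have hR : ω.rateRight * (if z = rightSite N then 1 - 2 * ω.eta z else 0)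
      = if (z : ℕ) = N then 1 / 2 * (ω.occ (z + 1) - ω.eta z) else 0 := by
    by_cases h : z = rightSite N
    · subst h
      simp only [if_true, State.rateRight_mul]
      simp [rightSite, State.occ_last]
    · rw [if_neg h, mul_zero, if_neg]
      exact fun h' => h (Subtype.ext h')
  rw [hL, hR]
  split_ifs <;> ring

theorem generator_occ_zero (hM : 1 ≤ M) (ω : State N M) :
    M * generator N M (fun ω => ω.occ 0) ω = 1 / 2 * (ω.occ 1 - ω.occ 0) := by
  have h1 : ω.occ 1 = ω.eta (leftSite N) := ω.occ_channel (leftSite N)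
  rw [generator_apply, h1]
  simp only [State.occ_zero]
  rw [← State.rateLeft_mul_densMinus hM]
  have h2 : ∀ x y, (ω.exchange x y).densMinus = ω.densMinus := fun _ _ => rfl
  have h3 : ω.flipRight.densMinus = ω.densMinus := rfl
  simp only [h2, h3, sub_self, Finset.sum_const_zero]
  ring

theorem generator_occ_last (hM : 1 ≤ M) (ω : State N M) :
    M * generator N M (fun ω => ω.occ (N + 1)) ω = 1 / 2 * (ω.occ N - ω.occ (N + 1)) := by
  have h1 : ω.occ N = ω.eta (rightSite N) := ω.occ_channel (rightSite N)
  rw [generator_apply, h1]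
  simp only [State.occ_last]
  rw [← State.rateRight_mul_densPlus hM]
  have h2 : ∀ x y, (ω.exchange x y).densPlus = ω.densPlus := fun _ _ => rfl
  have h3 : ω.flipLeft.densPlus = ω.densPlus := rfl
  simp only [h2, h3, sub_self, Finset.sum_const_zero]
  ring

/-- The densities satisfy a closed discrete heat equation. -/
theorem mass_mul_generator_occ (hM : 1 ≤ M) (ω : State N M) {x : ℕ} (hx : x ≤ N + 1) :
    mass N M x * generator N M (fun ω => ω.occ x) ω
      = 1 / 2 * (current N ω.occ (x + 1) - current N ω.occ x) := by
  rcases Nat.eq_zero_or_pos x with rfl | h0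
  · rw [current_zero, current_succ (by omega), mass, if_pos (Or.inl rfl), generator_occ_zero hM]
    simp
  · obtain ⟨y, rfl⟩ : ∃ y, x = y + 1 := ⟨x - 1, by omega⟩
    rcases hx.eq_or_lt with h | h
    · obtain rfl : y = N := by omega
      rw [current_last, current_succ (by omega), mass, if_pos (Or.inr rfl), generator_occ_last hM]
      ring
    · rw [current_succ h, current_succ (by omega), mass, if_neg (by omega), one_mul]
      exact generator_occ_channel ω ⟨y + 1, Finset.mem_Icc.2 (by omega)⟩

end Generator

/-! ### Expectations -/

theorem measurable_comp_of_finite {S : Type*} [Finite S] [MeasurableSpace S]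
    [MeasurableSingletonClass S] {Ω : Type*} [MeasurableSpace Ω] {Y : Ω → S} (hY : Measurable Y)
    (f : S → ℝ) : Measurable fun a => f (Y a) :=
  (measurable_of_finite f).comp hY

theorem integrable_comp_of_finite {S : Type*} [Finite S] [MeasurableSpace S]
    [MeasurableSingletonClass S] {Ω : Type*} [MeasurableSpace Ω] (P : Measure Ω)
    [IsFiniteMeasure P] {Y : Ω → S} (hY : Measurable Y) (f : S → ℝ) :
    Integrable (fun a => f (Y a)) P := by
  obtain ⟨C, hC⟩ := (Set.finite_range fun s => ‖f s‖).bddAbove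
  exact Integrable.of_bound (measurable_comp_of_finite hY f).aestronglyMeasurable C
    (ae_of_all _ fun a => hC ⟨Y a, rfl⟩)

/-- The expectation `f ↦ E[f(Y)]` of functions of a random variable with finitely many values. -/
noncomputable def expectation {S : Type*} [Finite S] [MeasurableSpace S]
    [MeasurableSingletonClass S] {Ω : Type*} [MeasurableSpace Ω] (P : Measure Ω)
    [IsFiniteMeasure P] {Y : Ω → S} (hY : Measurable Y) : (S → ℝ) →ₗ[ℝ] ℝ where
  toFun f := ∫ a, f (Y a) ∂P
  map_add' f g :=
    integral_add (integrable_comp_of_finite P hY f) (integrable_comp_of_finite P hY g)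
  map_smul' c _ := integral_const_mul c _

/-- The Markov property from time `0`, integrated. -/
theorem IsMarkovProcess.integral_eq {S : Type*} [Fintype S] [mS : MeasurableSpace S]
    {L : (S → ℝ) →ₗ[ℝ] (S → ℝ)} {Ω : Type*} [MeasurableSpace Ω] {P : Measure Ω}
    [IsFiniteMeasure P] {X : ℝ≥0 → Ω → S} (hX : IsMarkovProcess L P X) (t : ℝ≥0) (f : S → ℝ) :
    ∫ a, f (X t a) ∂P = ∫ a, semigroup L t f (X 0 a) ∂P := by
  have hm : ⨆ u ≤ (0 : ℝ≥0), mS.comap (X u) ≤ ‹MeasurableSpace Ω› :=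
    iSup₂_le fun u _ => (hX.measurable u).comap_le
  rw [← integral_congr_ae (hX.markov 0 t f), integral_condExp hm, zero_add]

/-- The derivative is written with `A` next to `f`, so that the generator acts directly on the
occupation variables. -/
theorem hasDerivAt_exp_smul_apply {S : Type*} [Fintype S] (A : (S → ℝ) →L[ℝ] (S → ℝ))
    (φ : (S → ℝ) →L[ℝ] ℝ) (f : S → ℝ) (t : ℝ) :
    HasDerivAt (fun t : ℝ => φ (NormedSpace.exp (t • A) f))
      (φ (NormedSpace.exp (t • A) (A f))) t := by
  have h := (hasDerivAt_exp_smul_const (𝕂 := ℝ) A t).clm_apply (hasDerivAt_const t f)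
  refine (φ.hasFDerivAt.comp_hasDerivAt t h).congr_deriv ?_
  simp

theorem map_current_occ {N : ℕ+} {M : ℕ} (ψ : (State N M → ℝ) →ₗ[ℝ] ℝ) (x : ℕ) :
    ψ (fun ω => current N ω.occ x) = current N (fun y => ψ fun ω => ω.occ y) x := by
  unfold current
  split_ifs
  · exact map_zero ψ
  · exact map_sub ψ (fun ω => ω.occ x) fun ω => ω.occ (x - 1)

theorem rho_mem_Icc {N : ℕ+} {M : ℕ} {Ω : Type*} [MeasurableSpace Ω] (P : Measure Ω)
    [IsProbabilityMeasure P] {X : ℝ≥0 → Ω → State N M} {t : ℝ≥0} (hX : Measurable (X t)) (x : ℕ) :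
    rho P X x t ∈ Set.Icc (0 : ℝ) 1 := by
  have hi := integrable_comp_of_finite P hX fun ω : State N M => ω.occ x
  refine ⟨integral_nonneg fun a => (State.occ_mem_Icc _ x).1, ?_⟩
  refine (integral_mono hi (integrable_const 1) fun a => (State.occ_mem_Icc _ x).2).trans ?_
  simp

/-- Exponential convergence to equilibrium of the densities of the process. -/
theorem sq_rho_sub_meanDensity_le {N : ℕ+} {M : ℕ} (hM : 1 ≤ M) {Ω : Type*} [MeasurableSpace Ω]
    (P : Measure Ω) [IsProbabilityMeasure P] {X : ℝ≥0 → Ω → State N M}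
    (hX : IsMarkovProcess (generator N M) P X) {x : ℕ} (hx : x ≤ N + 1) (t : ℝ≥0) :
    (rho P X x t - meanDensity N M (fun y => rho P X y 0)) ^ 2
      ≤ (2 * M + N) * Real.exp (-(t / ((2 * M + N) * (N + 1)))) := by
  let A := LinearMap.toContinuousLinearMap (generator N M)
  let φ := LinearMap.toContinuousLinearMap (expectation P (hX.measurable 0))
  let W : ℕ → State N M → ℝ := fun x ω => ω.occ x
  -- The exponential also makes sense at negative times, so `u` is differentiable on all of `ℝ`; it
  -- equals `rho` for `t ≥ 0`.
  let u : ℕ → ℝ → ℝ := fun x t => φ (NormedSpace.exp (t • A) (W x))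
  let u' : ℕ → ℝ → ℝ := fun x t => φ (NormedSpace.exp (t • A) (A (W x)))
  have hrho : ∀ x (t : ℝ≥0), rho P X x t = u x t := fun x t => hX.integral_eq t (W x)
  have hrho0 : ∀ x, rho P X x 0 = u x 0 := fun x => by simpa using hrho x 0
  have hA : ∀ f, A f = generator N M f := fun f => rfl
  simp only [hrho0]
  rw [hrho]
  refine sq_sub_meanDensity_le hM u u' (fun x _ t => hasDerivAt_exp_smul_apply A φ (W x) t) ?_ ?_
    hx t.2
  · intro x hx t
    -- `ψ` is the expectation after the semigroup; being linear, it carries the pointwise identity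
    -- `hW` over to the densities.
    let ψ : (State N M → ℝ) →ₗ[ℝ] ℝ := (φ.comp (NormedSpace.exp (t • A))).toLinearMap
    have hc := fun x => map_current_occ ψ x
    have hW : mass N M x • A (W x) = (1 / 2 : ℝ) • ((fun ω : State N M => current N ω.occ (x + 1))
        - fun ω => current N ω.occ x) := by
      funext ω
      exact mass_mul_generator_occ hM ω hx
    have h := congrArg ψ hW
    rw [map_smul, map_smul, map_sub, hc, hc] at h
    exact h
  · intro x _
    rw [← hrho0]
    exact rho_mem_Icc P (hX.measurable 0) x

/-! ### Asymptotics -/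

theorem tendsto_pnat_cast_atTop : Tendsto (fun N : ℕ+ => ((N : ℕ) : ℝ)) atTop atTop :=
  tendsto_natCast_atTop_atTop.comp tendsto_PNat_val_atTop_atTop

theorem self_le_rpow {α : ℝ} (hα : 0 < α) (N : ℕ+) : ((N : ℕ) : ℝ) ≤ ((N : ℕ) : ℝ) ^ (1 + α) :=
  Real.self_le_rpow_of_one_le (by exact_mod_cast N.pos) (by linarith)

theorem one_le_reservoirSize {α : ℝ} (hα : 0 < α) (N : ℕ+) : 1 ≤ reservoirSize α N :=
  Nat.le_floor (by
    rw [Nat.cast_one]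
    exact le_trans (by exact_mod_cast N.pos) (self_le_rpow hα N))

theorem reservoirSize_le (α : ℝ) (N : ℕ+) : (reservoirSize α N : ℝ) ≤ ((N : ℕ) : ℝ) ^ (1 + α) :=
  Nat.floor_le (by positivity)

theorem rpow_le_two_mul_reservoirSize {α : ℝ} (hα : 0 < α) (N : ℕ+) :
    ((N : ℕ) : ℝ) ^ (1 + α) ≤ 2 * reservoirSize α N := by
  have h1 : (1 : ℝ) ≤ reservoirSize α N := by exact_mod_cast one_le_reservoirSize hα N
  have h2 : ((N : ℕ) : ℝ) ^ (1 + α) < reservoirSize α N + 1 := Nat.lt_floor_add_one _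
  linarith

theorem tendsto_div_reservoirSize {α : ℝ} (hα : 0 < α) :
    Tendsto (fun N : ℕ+ => ((N : ℕ) : ℝ) / reservoirSize α N) atTop (𝓝 0) := by
  have h := ((tendsto_rpow_neg_atTop hα).comp tendsto_pnat_cast_atTop).const_mul 2
  rw [mul_zero] at h
  refine squeeze_zero (fun N => by positivity) (fun N => ?_) h
  have hN : (0 : ℝ) < (N : ℕ) := by exact_mod_cast N.pos
  have h1 : (1 : ℝ) ≤ reservoirSize α N := by exact_mod_cast one_le_reservoirSize hα N
  rw [div_le_iff₀ (by linarith)]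
  have h2 := rpow_le_two_mul_reservoirSize hα N
  have h3 : ((N : ℕ) : ℝ) = ((N : ℕ) : ℝ) ^ (-α) * ((N : ℕ) : ℝ) ^ (1 + α) := by
    rw [← Real.rpow_add hN]; simp
  calc ((N : ℕ) : ℝ) = ((N : ℕ) : ℝ) ^ (-α) * ((N : ℕ) : ℝ) ^ (1 + α) := h3
    _ ≤ ((N : ℕ) : ℝ) ^ (-α) * (2 * reservoirSize α N) := by gcongr
    _ = 2 * ((N : ℕ) : ℝ) ^ (-α) * reservoirSize α N := by ring

theorem tendsto_relaxation_bound {α α' t : ℝ} (hα : 0 < α) (hα' : α < α') (ht : 0 < t) :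
    Tendsto (fun N : ℕ+ => (2 * (reservoirSize α N : ℝ) + (N : ℕ)) *
      Real.exp (-(((N : ℕ) : ℝ) ^ (2 + α') * t /
        ((2 * (reservoirSize α N : ℝ) + (N : ℕ)) * ((N : ℕ) + 1))))) atTop (𝓝 0) := by
  have hδ : 0 < α' - α := by linarith
  -- With `y = N^(α'-α)`, the prefactor is at most `3 N^(1+α) = 3 y^((1+α)/(α'-α))`. Since
  -- `(2M+N)(N+1) ≤ 3 N^(1+α) · 2N`, the exponent is at least `(t/6) y`.
  have h := (((tendsto_rpow_mul_exp_neg_mul_atTop_nhds_zero ((1 + α) / (α' - α)) (t / 6)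
    (by positivity)).comp (tendsto_rpow_atTop hδ)).comp tendsto_pnat_cast_atTop).const_mul 3
  rw [mul_zero] at h
  refine squeeze_zero (fun N => by positivity) (fun N => ?_) h
  have hN : (1 : ℝ) ≤ (N : ℕ) := by exact_mod_cast N.pos
  have hN0 : (0 : ℝ) < (N : ℕ) := by linarith
  have hZ : 2 * (reservoirSize α N : ℝ) + (N : ℕ) ≤ 3 * ((N : ℕ) : ℝ) ^ (1 + α) := by
    linarith [reservoirSize_le α N, self_le_rpow hα N]
  simp only [Function.comp_apply]
  rw [← Real.rpow_mul hN0.le, mul_div_cancel₀ _ hδ.ne', ← mul_assoc]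
  refine mul_le_mul hZ (Real.exp_le_exp.2 ?_) (Real.exp_pos _).le (by positivity)
  rw [neg_mul, neg_le_neg_iff, le_div_iff₀ (by positivity)]
  have hsplit : ((N : ℕ) : ℝ) ^ (2 + α')
      = ((N : ℕ) : ℝ) ^ (α' - α) * (((N : ℕ) : ℝ) ^ (1 + α) * (N : ℕ)) := by
    nth_rewrite 4 [← Real.rpow_one ((N : ℕ) : ℝ)]
    rw [← Real.rpow_add hN0, ← Real.rpow_add hN0]
    ring_nf
  calc t / 6 * ((N : ℕ) : ℝ) ^ (α' - α)
        * ((2 * (reservoirSize α N : ℝ) + (N : ℕ)) * ((N : ℕ) + 1))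
      ≤ t / 6 * ((N : ℕ) : ℝ) ^ (α' - α)
        * ((3 * ((N : ℕ) : ℝ) ^ (1 + α)) * (2 * (N : ℕ))) := by
        gcongr
        linarith
    _ = ((N : ℕ) : ℝ) ^ (2 + α') * t := by rw [hsplit]; ring

/-- At times of order `N ^ (2 + α')` the densities are close to the average of the initial
densities of the reservoirs. -/
theorem tendsto_rho {α : ℝ} (hα : 0 < α) {vMinus vPlus : ℝ} {Ω : ℕ+ → Type*}
    [∀ N, MeasurableSpace (Ω N)] (P : ∀ N : ℕ+, Measure (Ω N)) [∀ N, IsProbabilityMeasure (P N)]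
    {X : ∀ N : ℕ+, ℝ≥0 → Ω N → State N (reservoirSize α N)}
    (hX : ∀ N : ℕ+, IsMarkovProcess (generator N (reservoirSize α N)) (P N) (X N))
    (hInitMinus : ∀ N : ℕ+, rho (P N) (X N) 0 0 = vMinus)
    (hInitPlus : ∀ N : ℕ+, rho (P N) (X N) (N + 1) 0 = vPlus)
    {α' : ℝ} (hα' : α < α') {t : ℝ≥0} (ht : 0 < t) {x : ℕ+ → ℕ} (hx : ∀ N, x N ≤ N + 1) :
    Tendsto (fun N : ℕ+ => rho (P N) (X N) (x N) (((N : ℕ) : ℝ≥0) ^ (2 + α') * t)) atTop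
      (𝓝 ((vMinus + vPlus) / 2)) := by
  have hmean : Tendsto (fun N : ℕ+ => meanDensity N (reservoirSize α N)
      (fun y => rho (P N) (X N) y 0)) atTop (𝓝 ((vMinus + vPlus) / 2)) := by
    rw [tendsto_iff_norm_sub_tendsto_zero]
    refine squeeze_zero (fun _ => norm_nonneg _) (fun N => ?_) (tendsto_div_reservoirSize hα)
    have := abs_meanDensity_sub_le (one_le_reservoirSize hα N) (N := N)
      fun y _ => rho_mem_Icc (P N) ((hX N).measurable 0) y
    rwa [hInitMinus, hInitPlus] at this
  have hdiff : Tendsto (fun N : ℕ+ => rho (P N) (X N) (x N) (((N : ℕ) : ℝ≥0) ^ (2 + α') * t)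
      - meanDensity N (reservoirSize α N) (fun y => rho (P N) (X N) y 0)) atTop (𝓝 0) := by
    have hsqrt := (Real.continuous_sqrt.tendsto 0).comp
      (tendsto_relaxation_bound hα hα' (NNReal.coe_pos.2 ht))
    rw [Real.sqrt_zero] at hsqrt
    refine squeeze_zero_norm (fun N => ?_) hsqrt
    refine Real.le_sqrt_of_sq_le ?_
    rw [Real.norm_eq_abs, sq_abs]
    simpa using sq_rho_sub_meanDensity_le (one_le_reservoirSize hα N) (P N) (hX N) (hx N)
      (((N : ℕ) : ℝ≥0) ^ (2 + α') * t)
  simpa using hdiff.add hmean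

end SSEPReservoirs

theorem mainTheorem5 (α : ℝ) (hα : 0 < α) (vMinus vPlus : ℝ)
    (hvMinus : vMinus ∈ Set.Icc (0 : ℝ) 1) (hvPlus : vPlus ∈ Set.Icc (0 : ℝ) 1)
    {Ω : ℕ+ → Type*} [∀ N, MeasurableSpace (Ω N)]
    (P : ∀ N : ℕ+, Measure (Ω N)) [∀ N, IsProbabilityMeasure (P N)]
    (X : ∀ N : ℕ+, ℝ≥0 → Ω N → SSEPReservoirs.State N (SSEPReservoirs.reservoirSize α N))
    (hX : ∀ N : ℕ+, SSEPReservoirs.IsMarkovProcess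
      (SSEPReservoirs.generator N (SSEPReservoirs.reservoirSize α N)) (P N) (X N))
    (hInitMinus : ∀ N : ℕ+, SSEPReservoirs.rho (P N) (X N) 0 0 = vMinus)
    (hInitPlus : ∀ N : ℕ+, SSEPReservoirs.rho (P N) (X N) (N + 1) 0 = vPlus)
    (α' : ℝ) (hα' : α < α') (t : ℝ≥0) (ht : 0 < t) :
    (∀ r ∈ Set.Icc (0 : ℝ) 1,
      Tendsto (fun N : ℕ+ => SSEPReservoirs.rho (P N) (X N) ⌊((N : ℕ) : ℝ) * r⌋₊
        (((N : ℕ) : ℝ≥0) ^ (2 + α') * t)) atTop (𝓝 ((vMinus + vPlus) / 2))) ∧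
    Tendsto (fun N : ℕ+ => SSEPReservoirs.rho (P N) (X N) 0
      (((N : ℕ) : ℝ≥0) ^ (2 + α') * t)) atTop (𝓝 ((vMinus + vPlus) / 2)) ∧
    Tendsto (fun N : ℕ+ => SSEPReservoirs.rho (P N) (X N) (N + 1)
      (((N : ℕ) : ℝ≥0) ^ (2 + α') * t)) atTop (𝓝 ((vMinus + vPlus) / 2)) := by
  refine ⟨fun r hr => ?_, ?_, ?_⟩
  · refine SSEPReservoirs.tendsto_rho hα P hX hInitMinus hInitPlus hα' ht fun N => ?_
    -- The site `[Nr]` may be `0`, the left reservoir; the estimate is uniform over `{0, …, N+1}`,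
    -- so no case distinction is needed.
    refine (Nat.floor_le_of_le (?_ : ((N : ℕ) : ℝ) * r ≤ (N : ℕ))).trans (Nat.le_succ _)
    exact mul_le_of_le_one_right (Nat.cast_nonneg _) hr.2
  · exact SSEPReservoirs.tendsto_rho hα P hX hInitMinus hInitPlus hα' ht fun N => Nat.zero_le _
  · exact SSEPReservoirs.tendsto_rho hα P hX hInitMinus hInitPlus hα' ht fun N => le_rfl
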